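/- Let $X$ be a finite set and let $X^*$ be the rooted tree of finite words over $X$, whose root is the empty word and in which the children of a word $v$ are the words $vx$ with $x\in X$. For an automorphism $g$ of the rooted tree $X^*$ and a word $v$, let $g|_v$ be the section of $g$ at $v$, that is, the automorphism of $X^*$ determined by $g(vw)=g(v)\,g|_v(w)$ for all words $w$. Call $g$ finite-state if the set $\{g|_v : v\in X^*\}$ is finite, and bounded (of bounded activity growth) if the numbers $\alpha_n(g)$ of words $v$ of length $n$ with $g|_v\neq 1$ form a bounded sequence. A (discrete) group $G$ is amenable if there is a finitely additive map $\mu$ from the set of all subsets of $G$ to $[0,1]$ with $\mu(G)=1$ and $\mu(gA)=\mu(A)$ for all $g\in G$ and $A\subseteq G$. Theorem. For every finite set $X$, every group generated by a (not necessarily finite) set of finite-state bounded automorphisms of $X^*$ is amenable. In particular, this covers the following two groups of automorphisms of the binary tree $\{0,1\}^*$, whose given generators are finite-state and bounded, and which are therefore amenable: (a) the Grigorchuk group, generated by the automorphisms $a,b,c,d$ defined by $a(0v)=1v$, $a(1v)=0v$; $b(0v)=0a(v)$, $b(1v)=1c(v)$; $c(0v)=0a(v)$, $c(1v)=1d(v)$;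 $d(0v)=0v$, $d(1v)=1b(v)$; (b) the Basilica group, generated by the automorphisms $a,b$ defined by $a(0v)=1v$, $a(1v)=0b(v)$; $b(0v)=0v$, $b(1v)=1a(v)$. -/

import Mathlib

/-- An action of a (discrete) group `G` on a set `X` is amenable if there is an invariant mean: a
finitely additive map `μ` from the set of all subsets of `X` to `[0, 1]` with `μ X = 1` and
`μ (g A) = μ A` for all `A ⊆ X` and `g ∈ G`. -/
def IsAmenableAction (G X : Type*) [Group G] [MulAction G X] : Prop :=
  ∃ μ : Set X → ℝ,
    (∀ A, 0 ≤ μ A ∧ μ A ≤ 1) ∧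
    (∀ A B, Disjoint A B → μ (A ∪ B) = μ A + μ B) ∧
    μ Set.univ = 1 ∧
    ∀ (g : G) (A : Set X), μ ((fun x => g • x) '' A) = μ A

/-- A group is amenable if its action on itself by left multiplication is amenable. -/
def IsAmenableGroup (G : Type*) [Group G] : Prop :=
  IsAmenableAction G G

theorem permInvApply {X : Type*} (g : Equiv.Perm X) (x : X) : g⁻¹ (g x) = x :=
  g.symm_apply_apply x

theorem permApplyInv {X : Type*} (g : Equiv.Perm X) (x : X) : g (g⁻¹ x) = x :=
  g.apply_symm_apply x

/-- The automorphism group of the rooted tree `X*`. The vertices of `X*` are the finite words over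
`X`, the root is the empty word, and the children of a word `v` are the words `v x`, `x ∈ X`. -/
def TreeAut (X : Type*) : Subgroup (Equiv.Perm (List X)) where
  carrier := {g | g [] = [] ∧
    ∀ v w : List X, (∃ x, w = v ++ [x]) ↔ (∃ y, g w = g v ++ [y])}
  one_mem' := ⟨rfl, fun _ _ => Iff.rfl⟩
  mul_mem' := by
    rintro g h ⟨hg0, hg⟩ ⟨hh0, hh⟩
    refine ⟨?_, fun v w => ?_⟩
    · rw [Equiv.Perm.mul_apply, hh0, hg0]
    · rw [Equiv.Perm.mul_apply, Equiv.Perm.mul_apply, hh v w, hg (h v) (h w)]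
  inv_mem' := by
    rintro g ⟨hg0, hg⟩
    refine ⟨?_, fun v w => ?_⟩
    · rw [Equiv.Perm.inv_eq_iff_eq, hg0]
    · have := hg (g⁻¹ v) (g⁻¹ w)
      rw [permApplyInv, permApplyInv] at this
      exact this.symm

namespace TreeAut

variable {X : Type*}

theorem apply_append (g : TreeAut X) (v w : List X) :
    ∃ t, g.1 (v ++ w) = g.1 v ++ t := by
  induction w using List.reverseRecOn with
  | nil => exact ⟨[], by simp⟩
  | append_singleton w x ih =>
    obtain ⟨t, ht⟩ := ih
    obtain ⟨y, hy⟩ := (g.2.2 (v ++ w) (v ++ w ++ [x])).1 ⟨x, rfl⟩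
    exact ⟨t ++ [y], by rw [← List.append_assoc, hy, ht, List.append_assoc]⟩

theorem length_apply (g : TreeAut X) (v : List X) : (g.1 v).length = v.length := by
  induction v using List.reverseRecOn with
  | nil => rw [g.2.1]
  | append_singleton v x ih =>
    obtain ⟨y, hy⟩ := (g.2.2 v (v ++ [x])).1 ⟨x, rfl⟩
    rw [hy, List.length_append, List.length_append, ih]
    rfl

theorem apply_append_drop (g : TreeAut X) (v w : List X) :
    g.1 v ++ (g.1 (v ++ w)).drop v.length = g.1 (v ++ w) := by
  obtain ⟨t, ht⟩ := apply_append g v w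
  rw [ht, List.drop_left' (length_apply g v)]

/-- The section `g|_v` of `g` at the vertex `v`: the automorphism of the tree that is determined by
`g (v w) = g (v) (g|_v) (w)` for all words `w`. -/
def sect (g : TreeAut X) (v : List X) : TreeAut X :=
  ⟨{ toFun := fun w => (g.1 (v ++ w)).drop v.length
     invFun := fun w => (g.1⁻¹ (g.1 v ++ w)).drop v.length
     left_inv := fun w => by
       show (g.1⁻¹ (g.1 v ++ (g.1 (v ++ w)).drop v.length)).drop v.length = w
       rw [apply_append_drop, permInvApply, List.drop_left' rfl]
     right_inv := fun w => by
       show (g.1 (v ++ (g.1⁻¹ (g.1 v ++ w)).drop v.length)).drop v.length = w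
       have h := apply_append_drop g⁻¹ (g.1 v) w
       rw [length_apply] at h
       change g.1⁻¹ (g.1 v) ++ (g.1⁻¹ (g.1 v ++ w)).drop v.length = g.1⁻¹ (g.1 v ++ w) at h
       rw [permInvApply] at h
       rw [h, permApplyInv, List.drop_left' (length_apply g v)] },
   by
     refine ⟨?_, fun u w => ?_⟩
     · show (g.1 (v ++ [])).drop v.length = []
       rw [List.append_nil, ← length_apply g v, List.drop_length]
     · show (∃ x, w = u ++ [x]) ↔
         ∃ y, (g.1 (v ++ w)).drop v.length = (g.1 (v ++ u)).drop v.length ++ [y]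
       have h1 : (∃ x, w = u ++ [x]) ↔ ∃ x, v ++ w = v ++ u ++ [x] := by
         simp only [List.append_assoc, List.append_cancel_left_eq]
       rw [h1, g.2.2 (v ++ u) (v ++ w), ← apply_append_drop g v w, ← apply_append_drop g v u]
       simp only [List.append_assoc, List.append_cancel_left_eq,
         List.drop_left' (length_apply g v)]⟩

theorem apply_append_sect (g : TreeAut X) (v w : List X) :
    g.1 (v ++ w) = g.1 v ++ (sect g v).1 w :=
  (apply_append_drop g v w).symm

/-- `g` is finite-state if it has only finitely many different sections; equivalently, it is defined
by a state of a finite automaton. -/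
def IsFiniteState (g : TreeAut X) : Prop :=
  {h : TreeAut X | ∃ v : List X, sect g v = h}.Finite

/-- The activity `α_n(g)`: the number of words `v` of length `n` such that `g|_v` is non-trivial.
(For a finite alphabet the set that is counted is finite.) -/
noncomputable def activity (g : TreeAut X) (n : ℕ) : ℕ :=
  {v : List X | v.length = n ∧ sect g v ≠ 1}.ncard

/-- `g` is bounded if the sequence `α_n(g)` is bounded. -/
def IsBounded (g : TreeAut X) : Prop :=
  ∃ C : ℕ, ∀ n : ℕ, activity g n ≤ C

end TreeAut

/-- An invertible automaton over the alphabet `X` with set of states `Q`: in the state `q` it reads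
a letter `x`, writes `out q x` and passes to the state `next q x`. -/
structure InvertibleAutomaton (X Q : Type*) where
  out : Q → Equiv.Perm X
  next : Q → X → Q

namespace InvertibleAutomaton

variable {X Q : Type*}

/-- The word that the automaton writes when it reads a given word, starting in the state `q`. -/
def run (A : InvertibleAutomaton X Q) : Q → List X → List X
  | _, [] => []
  | q, x :: w => A.out q x :: A.run (A.next q x) w

/-- The inverse of `run`: it recovers the word that was read from the word that was written. -/
def runInv (A : InvertibleAutomaton X Q) : Q → List X → List X
  | _, [] => []
  | q, y :: w => (A.out q).symm y :: A.runInv (A.next q ((A.out q).symm y)) w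

theorem runInv_run (A : InvertibleAutomaton X Q) (q : Q) (w : List X) :
    A.runInv q (A.run q w) = w := by
  induction w generalizing q with
  | nil => rfl
  | cons x w ih => simp [run, runInv, ih]

theorem run_runInv (A : InvertibleAutomaton X Q) (q : Q) (w : List X) :
    A.run q (A.runInv q w) = w := by
  induction w generalizing q with
  | nil => rfl
  | cons x w ih => simp [run, runInv, ih]

theorem run_child_iff (A : InvertibleAutomaton X Q) (q : Q) (v w : List X) :
    (∃ x, w = v ++ [x]) ↔ ∃ y, A.run q w = A.run q v ++ [y] := by
  induction v generalizing q w with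
  | nil =>
    rcases w with _ | ⟨a, _ | ⟨b, w⟩⟩ <;> simp [run]
  | cons c v ih =>
    rcases w with _ | ⟨a, w⟩
    · simp [run]
    · simp only [run, List.cons_append, List.cons.injEq, exists_and_left,
        EmbeddingLike.apply_eq_iff_eq]
      refine and_congr_right ?_
      rintro rfl
      exact ih (A.next q a) w

/-- The automorphism of the tree `X*` defined by the state `q` of the automaton. It satisfies
`q (x w) = (out q x) ((next q x) (w))`. -/
def toTreeAut (A : InvertibleAutomaton X Q) (q : Q) : TreeAut X :=
  ⟨{ toFun := A.run q
     invFun := A.runInv q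
     left_inv := A.runInv_run q
     right_inv := A.run_runInv q },
   rfl, A.run_child_iff q⟩

end InvertibleAutomaton

/-- The five states of the Grigorchuk automaton; `e` is the trivial state. -/
inductive GrigorchukState
  | a | b | c | d | e

/-- The Grigorchuk automaton:
`a(0v) = 1v`, `a(1v) = 0v`; `b(0v) = 0a(v)`, `b(1v) = 1c(v)`;
`c(0v) = 0a(v)`, `c(1v) = 1d(v)`; `d(0v) = 0v`, `d(1v) = 1b(v)`. -/
def grigorchukAutomaton : InvertibleAutomaton (Fin 2) GrigorchukState where
  out
    | .a => Equiv.swap 0 1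
    | _ => 1
  next
    | .a, _ => .e
    | .b, 0 => .a
    | .b, 1 => .c
    | .c, 0 => .a
    | .c, 1 => .d
    | .d, 0 => .e
    | .d, 1 => .b
    | .e, _ => .e

/-- The standard generators `a, b, c, d` of the Grigorchuk group. -/
def grigorchukGenerators : Set (TreeAut (Fin 2)) :=
  {grigorchukAutomaton.toTreeAut .a, grigorchukAutomaton.toTreeAut .b,
    grigorchukAutomaton.toTreeAut .c, grigorchukAutomaton.toTreeAut .d}

/-- The three states of the Basilica automaton; `e` is the trivial state. -/
inductive BasilicaState
  | a | b | e

/-- The Basilica automaton: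
`a(0v) = 1v`, `a(1v) = 0b(v)`; `b(0v) = 0v`, `b(1v) = 1a(v)`. -/
def basilicaAutomaton : InvertibleAutomaton (Fin 2) BasilicaState where
  out
    | .a => Equiv.swap 0 1
    | _ => 1
  next
    | .a, 0 => .e
    | .a, 1 => .b
    | .b, 0 => .e
    | .b, 1 => .a
    | .e, _ => .e

/-- The standard generators `a, b` of the Basilica group. -/
def basilicaGenerators : Set (TreeAut (Fin 2)) :=
  {basilicaAutomaton.toTreeAut .a, basilicaAutomaton.toTreeAut .b}

/-! Finitary automorphisms form an increasing union of finite groups, so some mean on `TreeAut X` is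
invariant under `finitary X`; it translates to every coset `g * finitary X`. For a group `G`
generated by a finite set `T` of generators, it therefore suffices to find probabilities on the
cosets of elements of `G` that are almost invariant under `T`. They come from random finite sets of
rays.

Boundedness leaves each generator only finitely many singular rays. For a finite set `E` of rays,
consider the cosets of those `g ∈ G` for which all singular rays of `g⁻¹` lie in `E`. Because
generators are finite-state, this set of cosets is finite (`finite_cosetsOver`): along a ray only
finitely many germs occur. A generator `s` carries it exactly onto the set for `s • E` once `E`
contains the singular rays of `s` (`image_smul_cosetsOver`). So one averages uniformly over the
cosets for a random `E` that almost surely contains these rays and whose law is almost invariant.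

Such a law exists because the action on rays is recurrent: there are finitely supported functions
`a` of small energy that equal 1 at the singular rays (`exists_small_energy_singular`). Each ray `x`
is put into `E` independently with probability `sin² (π a(x) / 2)`; the law then moves under `s` by
at most a constant times the square root of the energy (`abs_expect_sub_le`). An ultrafilter limit
over finite sets of generators and over `ε` gives an invariant mean on `TreeAut X`, which is pushed
forward to the subgroup. -/

namespace TreeAut

variable {X : Type*}

/-! ### Calculus of sections. -/

theorem ext_apply {g h : TreeAut X} (H : ∀ w, g.1 w = h.1 w) : g = h :=
  Subtype.ext (Equiv.ext H)

theorem mul_val_apply (g h : TreeAut X) (w : List X) : (g * h).1 w = g.1 (h.1 w) := rfl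

theorem inv_val_apply (g : TreeAut X) (w : List X) : (g⁻¹).1 (g.1 w) = w :=
  permInvApply g.1 w

theorem val_inv_apply (g : TreeAut X) (w : List X) : g.1 ((g⁻¹).1 w) = w :=
  permApplyInv g.1 w

theorem sect_eq_of_forall {g h : TreeAut X} {v : List X}
    (H : ∀ w, g.1 (v ++ w) = g.1 v ++ h.1 w) : sect g v = h :=
  ext_apply fun w => List.append_cancel_left ((apply_append_sect g v w).symm.trans (H w))

theorem sect_one (v : List X) : sect (1 : TreeAut X) v = 1 :=
  sect_eq_of_forall fun _ => rfl

theorem sect_mul (g h : TreeAut X) (v : List X) :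
    sect (g * h) v = sect g (h.1 v) * sect h v :=
  sect_eq_of_forall fun w => by
    rw [mul_val_apply, apply_append_sect, apply_append_sect]; rfl

theorem sect_append (g : TreeAut X) (v w : List X) : sect g (v ++ w) = sect (sect g v) w :=
  sect_eq_of_forall fun u => by
    rw [List.append_assoc, apply_append_sect, apply_append_sect, apply_append_sect g v w,
      List.append_assoc]

theorem sect_inv (g : TreeAut X) (v : List X) : sect g⁻¹ (g.1 v) = (sect g v)⁻¹ := by
  rw [eq_inv_iff_mul_eq_one, ← sect_mul, inv_mul_cancel, sect_one]

theorem sect_inv' (g : TreeAut X) (v : List X) : sect g⁻¹ v = (sect g ((g⁻¹).1 v))⁻¹ := by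
  rw [← sect_inv, val_inv_apply]

theorem sect_eq_one_of_prefix {g : TreeAut X} {v w : List X} (hvw : v <+: w)
    (hv : sect g v = 1) : sect g w = 1 := by
  obtain ⟨u, rfl⟩ := hvw
  rw [sect_append, hv, sect_one]

theorem apply_prefix (g : TreeAut X) {v w : List X} (h : v <+: w) : g.1 v <+: g.1 w := by
  obtain ⟨u, rfl⟩ := h
  obtain ⟨t, ht⟩ := apply_append g v u
  exact ⟨t, ht.symm⟩

theorem apply_prefix_iff (g : TreeAut X) {v w : List X} : g.1 v <+: g.1 w ↔ v <+: w := by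
  refine ⟨fun h => ?_, apply_prefix g⟩
  have := apply_prefix g⁻¹ h
  rwa [inv_val_apply, inv_val_apply] at this

end TreeAut

/-! ### Rays and the action on them. -/

/-- The rays of the tree of words over `X`, given by their sequences of vertices. -/
def Ray (X : Type*) : Type _ :=
  {x : ℕ → List X // ∀ n, (x n).length = n ∧ x n <+: x (n + 1)}

namespace Ray

variable {X : Type*}

instance : CoeFun (Ray X) fun _ => ℕ → List X := ⟨Subtype.val⟩

@[ext]
theorem ext {x y : Ray X} (h : ∀ n, x n = y n) : x = y := Subtype.ext (funext h)

theorem length_apply (x : Ray X) (n : ℕ) : (x n).length = n := (x.2 n).1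

theorem prefix_of_le (x : Ray X) {m n : ℕ} (h : m ≤ n) : x m <+: x n := by
  induction n, h using Nat.le_induction with
  | base => exact List.prefix_rfl
  | succ n _ ih => exact ih.trans (x.2 n).2

theorem take_apply (x : Ray X) {m n : ℕ} (h : m ≤ n) : (x n).take m = x m := by
  have := (List.prefix_iff_eq_take.1 (x.prefix_of_le h)).symm
  rwa [x.length_apply] at this

theorem eq_of_le {x y : Ray X} {m n : ℕ} (h : m ≤ n) (hxy : x n = y n) : x m = y m := by
  rw [← take_apply x h, ← take_apply y h, hxy]

theorem append_drop (x : Ray X) (m k : ℕ) : x m ++ (x (m + k)).drop m = x (m + k) := by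
  conv_rhs => rw [← List.take_append_drop m (x (m + k)), take_apply x (Nat.le_add_right m k)]

instance : MulAction (TreeAut X) (Ray X) where
  smul g x := ⟨fun n => g.1 (x n), fun n =>
    ⟨by rw [TreeAut.length_apply, x.length_apply], TreeAut.apply_prefix g (x.2 n).2⟩⟩
  one_smul _ := rfl
  mul_smul _ _ _ := rfl

theorem smul_apply (g : TreeAut X) (x : Ray X) (n : ℕ) : (g • x) n = g.1 (x n) := rfl

theorem eventually_injOn {R : Set (Ray X)} (hR : R.Finite) :
    ∀ᶠ n in Filter.atTop, Set.InjOn (fun x : Ray X => x n) R := by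
  have key : ∀ x ∈ R, ∀ y ∈ R, ∀ᶠ n in Filter.atTop, x n = y n → x = y := by
    intro x _ y _
    by_cases hxy : x = y
    · exact Filter.Eventually.of_forall fun _ _ => hxy
    · obtain ⟨m, hm⟩ : ∃ m, x m ≠ y m := by
        by_contra! h
        exact hxy (Ray.ext h)
      filter_upwards [Filter.eventually_ge_atTop m] with n hn h
      exact absurd (eq_of_le hn h) hm
  have := (hR.eventually_all).2 fun x hx => (hR.eventually_all).2 (key x hx)
  filter_upwards [this] with n hn x hx y hy h
  exact hn x hx y hy h

end Ray

/-! ### Singular rays. -/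

namespace TreeAut

variable {X : Type*}

/-- The singular rays of `g`: those along which no section of `g` is trivial. -/
def singular (g : TreeAut X) : Set (Ray X) := {x | ∀ n, sect g (x n) ≠ 1}

theorem eventually_sect_eq_one {g : TreeAut X} {x : Ray X} (hx : x ∉ singular g) :
    ∀ᶠ n in Filter.atTop, sect g (x n) = 1 := by
  obtain ⟨m, hm⟩ : ∃ m, sect g (x m) = 1 := by
    by_contra! h
    exact hx h
  filter_upwards [Filter.eventually_ge_atTop m] with n hn
  exact sect_eq_one_of_prefix (x.prefix_of_le hn) hm

theorem singular_mul_subset (g h : TreeAut X) {x : Ray X} (hx : x ∈ singular (g * h)) :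
    x ∈ singular h ∨ h • x ∈ singular g := by
  by_contra! H
  obtain ⟨n, h1, h2⟩ := ((eventually_sect_eq_one H.1).and (eventually_sect_eq_one H.2)).exists
  refine hx n ?_
  rw [sect_mul, h1, ← Ray.smul_apply, h2, one_mul]

theorem mem_singular_inv {g : TreeAut X} {x : Ray X} (hx : x ∈ singular g⁻¹) :
    g⁻¹ • x ∈ singular g := by
  intro n h
  apply hx n
  rw [sect_inv', ← Ray.smul_apply, h, inv_one]

theorem finite_length_eq [Finite X] (n : ℕ) : {v : List X | v.length = n}.Finite :=
  List.finite_length_eq X n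

theorem card_le_activity [Finite X] {g : TreeAut X} {n : ℕ} {V : Finset (Ray X)}
    (hV : ∀ y ∈ V, sect g (y n) ≠ 1) (hinj : Set.InjOn (fun x : Ray X => x n) V) :
    V.card ≤ activity g n := by
  rw [← Set.ncard_coe_finset, ← hinj.ncard_image]
  refine Set.ncard_le_ncard ?_ ((finite_length_eq n).subset fun v hv => hv.1)
  rintro _ ⟨x, hx, rfl⟩
  exact ⟨x.length_apply n, hV x hx⟩

/-- Any `C + 1` singular rays would pass, deep enough, through `C + 1` distinct vertices with
nontrivial sections. -/
theorem IsBounded.finite_singular [Finite X] {g : TreeAut X} (hg : IsBounded g) :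
    (singular g).Finite := by
  obtain ⟨C, hC⟩ := hg
  by_contra hinf
  obtain ⟨R, hRs, hRc⟩ := Set.Infinite.exists_subset_card_eq hinf (C + 1)
  obtain ⟨n, hn⟩ := (Ray.eventually_injOn R.finite_toSet).exists
  have h1 := card_le_activity (fun x hx => hRs hx n) hn
  have := hC n
  omega

/-- All sections of `g` at the vertices of level `n` are trivial. -/
def TrivialFrom (n : ℕ) (g : TreeAut X) : Prop := ∀ v : List X, v.length = n → sect g v = 1

theorem TrivialFrom.mono {g : TreeAut X} {m n : ℕ} (hmn : m ≤ n) (h : TrivialFrom m g) :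
    TrivialFrom n g := fun v hv =>
  sect_eq_one_of_prefix (List.take_prefix m v) (h _ (by rw [List.length_take]; omega))

/-- König's lemma: if `g|_v` is not finitary then some singular ray of `g` passes through `v`. -/
theorem exists_singular_through [Finite X] {g : TreeAut X} {v : List X}
    (hv : ∀ n, ¬ TrivialFrom n (sect g v)) : ∃ x ∈ singular g, x v.length = v := by
  have step : ∀ u : List X, (∀ n, ¬ TrivialFrom n (sect g u)) →
      ∃ a, ∀ n, ¬ TrivialFrom n (sect g (u ++ [a])) := by
    intro u hu
    by_contra! H
    choose f hf using H
    obtain ⟨M, hM⟩ := (Set.finite_range f).bddAbove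
    refine hu (M + 1) fun w hw => ?_
    obtain _ | ⟨a, w⟩ := w
    · simp at hw
    · have := ((hf a).mono (hM ⟨a, rfl⟩)) w (by simpa using hw)
      rwa [← sect_append, List.append_assoc, List.singleton_append, sect_append] at this
  let Y := {u : List X // ∀ n, ¬ TrivialFrom n (sect g u)}
  choose f hf using step
  let next : Y → Y := fun u => ⟨u.1 ++ [f u.1 u.2], hf u.1 u.2⟩
  let y : ℕ → Y := fun k => next^[k] ⟨v, hv⟩
  have hy : ∀ k, (y (k + 1)).1 = (y k).1 ++ [f (y k).1 (y k).2] := fun k => by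
    simp only [y, Function.iterate_succ_apply']; rfl
  have hlen : ∀ k, (y k).1.length = v.length + k := by
    intro k
    induction k with
    | zero => rfl
    | succ k ih => rw [hy, List.length_append, ih]; rfl
  have hpre : ∀ k, v <+: (y k).1 := by
    intro k
    induction k with
    | zero => exact List.prefix_rfl
    | succ k ih => rw [hy]; exact ih.trans (List.prefix_append _ _)
  -- The vertex `y n` lies at level `v.length + n`; truncation to length `n` also supplies the part
  -- of the ray above `v`.
  refine ⟨⟨fun n => (y n).1.take n, fun n => ⟨?_, ?_⟩⟩, fun n h => ?_, ?_⟩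
  · rw [List.length_take, hlen]; omega
  · have h1 : (y n).1.take n <+: (y n).1.take (n + 1) := List.take_prefix_take_left (by omega)
    have h2 : (y n).1.take (n + 1) <+: (y (n + 1)).1.take (n + 1) := by
      rw [hy]
      exact (List.prefix_append _ _).take _
    exact h1.trans h2
  · refine (y n).2 0 fun w _ => ?_
    rw [← sect_append]
    exact sect_eq_one_of_prefix ((List.take_prefix _ _).trans (List.prefix_append _ _)) h
  · exact (List.prefix_iff_eq_take.1 (hpre _)).symm

end TreeAut

/-! ### Finitary automorphisms and germs along a ray. -/

namespace TreeAut

variable {X : Type*}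

theorem exists_trivialFrom_of_singular_eq_empty [Finite X] {g : TreeAut X}
    (h : singular g = ∅) : ∃ n, TrivialFrom n g := by
  by_contra! H
  obtain ⟨x, hx, _⟩ := exists_singular_through (g := g) (v := []) (by
    have : sect g [] = g := sect_eq_of_forall fun w => by rw [g.2.1]; rfl
    rwa [this])
  rw [h] at hx
  exact hx

/-- The subgroup of finitary automorphisms whose sections at level `n` are trivial. -/
def finitaryLevel (X : Type*) (n : ℕ) : Subgroup (TreeAut X) where
  carrier := {g | TrivialFrom n g}
  one_mem' := fun v _ => sect_one v
  mul_mem' := by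
    intro g h hg hh v hv
    rw [sect_mul, hh v hv, hg _ (by rw [length_apply, hv]), one_mul]
  inv_mem' := by
    intro g hg v hv
    rw [sect_inv', hg _ (by rw [length_apply, hv]), inv_one]

theorem finitaryLevel_mono : Monotone (finitaryLevel X) := fun _ _ hmn _ hg =>
  TrivialFrom.mono hmn hg

/-- The group of finitary automorphisms. -/
def finitary (X : Type*) : Subgroup (TreeAut X) := ⨆ n, finitaryLevel X n

theorem mem_finitary {g : TreeAut X} : g ∈ finitary X ↔ ∃ n, TrivialFrom n g := by
  rw [finitary, Subgroup.mem_iSup_of_directed finitaryLevel_mono.directed_le]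
  rfl

/-- The action of the automorphism group on the words of length at most `d`. -/
def restrict (X : Type*) (d : ℕ) : TreeAut X →* Equiv.Perm {w : List X // w.length ≤ d} where
  toFun g := g.1.subtypePerm fun w => by rw [length_apply]
  map_one' := rfl
  map_mul' _ _ := rfl

theorem restrict_eq_iff {d : ℕ} {g h : TreeAut X} :
    restrict X d g = restrict X d h ↔ ∀ w : List X, w.length ≤ d → g.1 w = h.1 w := by
  rw [Equiv.ext_iff]
  constructor
  · intro H w hw
    exact congrArg Subtype.val (H ⟨w, hw⟩)
  · rintro H ⟨w, hw⟩
    exact Subtype.ext (H w hw)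

instance [Finite X] (d : ℕ) : Finite {w : List X // w.length ≤ d} :=
  (List.finite_length_le X d).to_subtype

theorem finite_finitaryLevel [Finite X] (n : ℕ) : Finite (finitaryLevel X n) := by
  refine Finite.of_injective (fun g : finitaryLevel X n => restrict X n g.1) ?_
  rintro ⟨g, hg⟩ ⟨h, hh⟩ H
  have H' := restrict_eq_iff.1 H
  refine Subtype.ext (ext_apply fun w => ?_)
  rcases le_total w.length n with hw | hw
  · exact H' w hw
  · have hl : (w.take n).length = n := by rw [List.length_take]; omega
    rw [← List.take_append_drop n w, apply_append_sect, apply_append_sect h, hg _ hl, hh _ hl,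
      H' _ hl.le]

/-- For all large `n`, the sections of `g` are trivial at the vertices of level `n + d` that branch
off the ray `x` at level `n`. -/
def TrivialOff (d : ℕ) (g : TreeAut X) (x : Ray X) : Prop :=
  ∀ᶠ n in Filter.atTop, ∀ v : List X, v.length = n + d → x n <+: v → ¬ x (n + 1) <+: v →
    sect g v = 1

theorem TrivialOff.one (d : ℕ) (x : Ray X) : TrivialOff d 1 x :=
  Filter.Eventually.of_forall fun _ v _ _ _ => sect_one v

/-- Since `h` maps the vertices branching off `x` at level `n` to those branching off `h • x` at
level `n`, the depth `d` does not grow under products. This makes one `d` serve a whole group. -/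
theorem TrivialOff.mul {d : ℕ} {g h : TreeAut X} {x : Ray X} (hg : TrivialOff d g (h • x))
    (hh : TrivialOff d h x) : TrivialOff d (g * h) x := by
  filter_upwards [hg, hh] with n h1 h2 v hv hn hn1
  rw [sect_mul, h2 v hv hn hn1, mul_one]
  refine h1 _ (by rw [length_apply, hv]) ?_ ?_
  · exact apply_prefix h hn
  · rwa [Ray.smul_apply, apply_prefix_iff]

theorem TrivialOff.inv {d : ℕ} {g : TreeAut X} {x : Ray X} (hg : TrivialOff d g (g⁻¹ • x)) :
    TrivialOff d g⁻¹ x := by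
  filter_upwards [hg] with n h1 v hv hn hn1
  rw [sect_inv', inv_eq_one]
  refine h1 _ (by rw [length_apply, hv]) ?_ ?_
  · exact apply_prefix g⁻¹ hn
  · rwa [Ray.smul_apply, apply_prefix_iff]

/-- Two automorphisms that are trivial off `x` and whose sections along `x` act in the same way on
short words have a common section along `x`. -/
theorem exists_sect_eq {d : ℕ} (hd : 0 < d) {g h : TreeAut X} {x : Ray X}
    (hg : TrivialOff d g x) (hh : TrivialOff d h x)
    (hr : ∀ᶠ n in Filter.atTop, restrict X d (sect g (x n)) = restrict X d (sect h (x n))) :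
    ∃ n, sect g (x n) = sect h (x n) := by
  obtain ⟨m, hm⟩ := Filter.eventually_atTop.1 (hg.and (hh.and hr))
  -- Induction on the length, for all `n` at once: a word whose first letter follows the ray is
  -- shortened by passing to level `n + 1`; any other word meets trivial sections after `d` letters.
  have key : ∀ L n, m ≤ n → ∀ w : List X, w.length = L →
      (sect g (x n)).1 w = (sect h (x n)).1 w := by
    intro L
    induction L with
    | zero =>
      intro n hn w hw
      exact restrict_eq_iff.1 (hm n hn).2.2 w (by omega)
    | succ L ih =>
      intro n hn w hw
      obtain ⟨h1, h2, h3⟩ := hm n hn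
      have h3 := restrict_eq_iff.1 h3
      rcases le_or_gt w.length d with hwd | hwd
      · exact h3 w hwd
      obtain _ | ⟨c, w⟩ := w
      · simp at hw
      by_cases hc : x (n + 1) = x n ++ [c]
      · have e := ih (n + 1) (by omega) w (by simpa using hw)
        rw [hc, sect_append, sect_append] at e
        rw [← List.singleton_append, apply_append_sect, apply_append_sect (sect h (x n)), e,
          h3 [c] hd]
      · have hl : ((c :: w).take d).length = d := by rw [List.length_take]; omega
        have hlen : (x n ++ (c :: w).take d).length = n + d := by
          rw [List.length_append, x.length_apply, hl]
        have hnp : ¬ x (n + 1) <+: x n ++ (c :: w).take d := by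
          intro hp
          apply hc
          refine List.IsPrefix.eq_of_length (l₁ := x (n + 1)) (l₂ := x n ++ [c]) ?_ ?_
          · refine List.prefix_of_prefix_length_le hp ?_ ?_
            · rw [List.prefix_append_right_inj]
              obtain ⟨e, rfl⟩ : ∃ e, d = e + 1 := ⟨d - 1, by omega⟩
              simp
            · simp [x.length_apply]
          · simp [x.length_apply]
        have t1 := h1 _ hlen (List.prefix_append _ _) hnp
        have t2 := h2 _ hlen (List.prefix_append _ _) hnp
        rw [sect_append] at t1 t2
        rw [← List.take_append_drop d (c :: w), apply_append_sect,
          apply_append_sect (sect h (x n)), t1, t2, h3 _ hl.le]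
  exact ⟨m, ext_apply fun w => key _ m le_rfl w rfl⟩

/-- A common bound on the depth of the finitary sections of `g`. -/
theorem IsFiniteState.exists_depth {g : TreeAut X} (hg : IsFiniteState g) :
    ∃ D, ∀ v, (∃ n, TrivialFrom n (sect g v)) → TrivialFrom D (sect g v) := by
  classical
  let f : TreeAut X → ℕ := fun h => if H : ∃ n, TrivialFrom n h then H.choose else 0
  obtain ⟨D, hD⟩ := (hg.image f).bddAbove
  refine ⟨D, fun v hv => ?_⟩
  have h1 : f (sect g v) ≤ D := hD ⟨_, ⟨v, rfl⟩, rfl⟩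
  have h2 : f (sect g v) = hv.choose := dif_pos hv
  exact (hv.choose_spec).mono (h2 ▸ h1)

/-- Once the singular rays are separated at level `n`, a vertex of level `n + 1` branching off the
singular ray `x` lies on no singular ray. By König's lemma its section is finitary, hence of depth
at most `D`; the extra 1 is the branching letter. -/
theorem trivialOff_of_isFiniteState [Finite X] {g : TreeAut X} (hg : (singular g).Finite) {D : ℕ}
    (hD : ∀ v, (∃ n, TrivialFrom n (sect g v)) → TrivialFrom D (sect g v)) (x : Ray X) :
    TrivialOff (D + 1) g x := by
  by_cases hx : x ∈ singular g
  · filter_upwards [Ray.eventually_injOn hg] with n hn v hv h1 h2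
    have hl : (v.take (n + 1)).length = n + 1 := by rw [List.length_take]; omega
    have hfin : ∃ k, TrivialFrom k (sect g (v.take (n + 1))) := by
      by_contra! H
      obtain ⟨y, hy, hyv⟩ := exists_singular_through H
      rw [hl] at hyv
      have hyn : y n = x n := by
        have e := y.take_apply (Nat.le_succ n)
        rw [Nat.succ_eq_add_one, hyv, List.take_take, min_eq_left (Nat.le_succ n)] at e
        rw [← e, List.prefix_iff_eq_take.1 h1, x.length_apply]
      have hxy : y = x := hn hy hx hyn
      subst hxy
      exact h2 (hyv ▸ List.take_prefix _ _)
    have := hD _ hfin (v.drop (n + 1)) (by rw [List.length_drop]; omega)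
    rwa [← sect_append, List.take_append_drop] at this
  · filter_upwards [eventually_sect_eq_one hx] with n hn v _ h1 _
    exact sect_eq_one_of_prefix h1 hn

/-! ### Finite families of cosets attached to finite sets of rays. -/

/-- The cosets of the finitary group that meet the subgroup `G` in an element whose inverse has all
its singular rays in `E`. -/
def cosetsOver (G : Subgroup (TreeAut X)) (E : Set (Ray X)) : Set (TreeAut X ⧸ finitary X) :=
  (fun g : TreeAut X => (g : TreeAut X ⧸ finitary X)) '' {g | g ∈ G ∧ singular g⁻¹ ⊆ E}

theorem cosetsOver_nonempty (G : Subgroup (TreeAut X)) (E : Set (Ray X)) :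
    (cosetsOver G E).Nonempty := by
  refine ⟨_, 1, ⟨G.one_mem, fun x hx => ?_⟩, rfl⟩
  exact absurd (by rw [inv_one, sect_one]) (hx 0)

theorem smul_mem_cosetsOver {G : Subgroup (TreeAut X)} {E : Set (Ray X)} {s : TreeAut X}
    (hs : s ∈ G) (hE : ∀ x ∈ singular s⁻¹, x ∈ (fun y => s • y) '' E)
    {c : TreeAut X ⧸ finitary X} (hc : c ∈ cosetsOver G E) :
    s • c ∈ cosetsOver G ((fun y => s • y) '' E) := by
  obtain ⟨g, ⟨hg, hgE⟩, rfl⟩ := hc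
  refine ⟨s * g, ⟨G.mul_mem hs hg, fun x hx => ?_⟩, rfl⟩
  rw [mul_inv_rev] at hx
  rcases singular_mul_subset _ _ hx with h | h
  · exact hE x h
  · exact ⟨s⁻¹ • x, hgE h, smul_inv_smul s x⟩

/-- Singular rays of `(s * g)⁻¹` come from `s⁻¹` or are `s`-translates of those of `g⁻¹`. The former
lie in `s • E` because they are `s`-images of singular rays of `s`; the reverse inclusion is the
same argument for `s⁻¹`. -/
theorem image_smul_cosetsOver {G : Subgroup (TreeAut X)} {E : Set (Ray X)} {s : TreeAut X}
    (hs : s ∈ G) (hE : singular s ⊆ E) :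
    (fun c => s • c) '' cosetsOver G E = cosetsOver G ((fun y => s • y) '' E) := by
  apply Set.Subset.antisymm
  · rintro _ ⟨c, hc, rfl⟩
    refine smul_mem_cosetsOver hs (fun x hx => ?_) hc
    exact ⟨s⁻¹ • x, hE (mem_singular_inv hx), smul_inv_smul s x⟩
  · intro c hc
    have e : (fun y : Ray X => s⁻¹ • y) '' ((fun y => s • y) '' E) = E := by
      rw [← Set.image_comp]
      simp
    refine ⟨s⁻¹ • c, ?_, smul_inv_smul s c⟩
    have := smul_mem_cosetsOver (E := (fun y => s • y) '' E) (G.inv_mem hs) (fun x hx => ?_) hc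
    · rwa [e] at this
    · rw [e]
      rw [inv_inv] at hx
      exact hE hx

theorem exists_trivialOff_closure [Finite X] {T : Set (TreeAut X)} (hT : T.Finite)
    (hfs : ∀ g ∈ T, IsFiniteState g) (hfin : ∀ g ∈ T, (singular g).Finite) :
    ∃ d, 0 < d ∧ ∀ g ∈ Subgroup.closure T, ∀ x, TrivialOff d g x := by
  have h1 : ∀ g ∈ T, ∀ᶠ D in Filter.atTop,
      ∀ v, (∃ n, TrivialFrom n (sect g v)) → TrivialFrom D (sect g v) := by
    intro g hg
    obtain ⟨D, hD⟩ := (hfs g hg).exists_depth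
    filter_upwards [Filter.eventually_ge_atTop D] with D' hD' v hv
    exact (hD v hv).mono hD'
  obtain ⟨D, hD⟩ := ((hT.eventually_all).2 h1).exists
  refine ⟨D + 1, D.succ_pos, fun g hg => ?_⟩
  induction hg using Subgroup.closure_induction with
  | mem g hg => exact trivialOff_of_isFiniteState (hfin g hg) (hD g hg)
  | one => exact TrivialOff.one _
  | mul g h _ _ hg hh => exact fun x => (hg _).mul (hh x)
  | inv g _ hg => exact fun x => (hg _).inv

/-- Along any ray, the actions on short words of the sections of the elements of a finitely
generated group are expressed through finitely many sequences. -/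
theorem exists_code {T : Set (TreeAut X)} (d : ℕ) {I : Type*} (τ : ℕ → I)
    (hτ : ∀ s ∈ T, ∀ x ∈ singular s,
      ∃ c : I → Equiv.Perm {w : List X // w.length ≤ d},
        ∀ n, restrict X d (sect s (x n)) = c (τ n))
    {g : TreeAut X} (hg : g ∈ Subgroup.closure T) :
    ∀ x : Ray X, ∃ c : I → Equiv.Perm {w : List X // w.length ≤ d},
      ∀ᶠ n in Filter.atTop, restrict X d (sect g (x n)) = c (τ n) := by
  induction hg using Subgroup.closure_induction with
  | mem s hs =>
    intro x
    by_cases hx : x ∈ singular s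
    · obtain ⟨c, hc⟩ := hτ s hs x hx
      exact ⟨c, Filter.Eventually.of_forall hc⟩
    · refine ⟨fun _ => 1, ?_⟩
      filter_upwards [eventually_sect_eq_one hx] with n hn
      rw [hn, map_one]
  | one => exact fun x => ⟨fun _ => 1, Filter.Eventually.of_forall fun n => by
      rw [sect_one, map_one]⟩
  | mul g h _ _ hg hh =>
    intro x
    obtain ⟨c, hc⟩ := hg (h • x)
    obtain ⟨c', hc'⟩ := hh x
    refine ⟨fun i => c i * c' i, ?_⟩
    filter_upwards [hc, hc'] with n h1 h2
    rw [sect_mul, map_mul, h2, ← Ray.smul_apply, h1]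
  | inv g _ hg =>
    intro x
    obtain ⟨c, hc⟩ := hg (g⁻¹ • x)
    refine ⟨fun i => (c i)⁻¹, ?_⟩
    filter_upwards [hc] with n h1
    rw [sect_inv', ← Ray.smul_apply, map_inv, h1]

/-- The coset of `g` is determined by the germs of `g⁻¹` along the rays in `E`: if `g⁻¹` and `h⁻¹`
have equal sections far along every ray, then `g⁻¹ * h` has no singular ray and is finitary. Each
germ is determined by the eventual action on words of length at most `d`, and hence by one of
finitely many codes. -/
theorem finite_cosetsOver [Finite X] {T : Set (TreeAut X)} (hT : T.Finite)
    (hfs : ∀ g ∈ T, IsFiniteState g) (hfin : ∀ g ∈ T, (singular g).Finite)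
    {E : Set (Ray X)} (hE : E.Finite) : (cosetsOver (Subgroup.closure T) E).Finite := by
  classical
  obtain ⟨d, hd, hoff⟩ := exists_trivialOff_closure hT hfs hfin
  have : Finite T := hT
  have : ∀ s : T, Finite (singular s.1) := fun s => hfin s.1 s.2
  let B := Equiv.Perm {w : List X // w.length ≤ d}
  -- `τ n` records the depth-`d` actions at level `n` of all generators along all their singular
  -- rays. As `I` and `B` are finite, `E → I → B` is finite.
  let I := (Σ s : T, singular s.1) → B
  let τ : ℕ → I := fun n p => restrict X d (sect p.1.1 (p.2.1.1 n))
  have hcode := fun (g : TreeAut X) (hg : g ∈ Subgroup.closure T) (x : Ray X) =>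
    exists_code (T := T) d τ (fun s hs y hy => ⟨fun i => i ⟨⟨s, hs⟩, ⟨y, hy⟩⟩, fun _ => rfl⟩) hg x
  choose code hcode using hcode
  have : Finite E := hE
  let Φ : Subgroup.closure T → (E → I → B) := fun g x => code g.1⁻¹ (inv_mem g.2) x.1
  have key : ∀ g h : Subgroup.closure T, singular g.1⁻¹ ⊆ E → singular h.1⁻¹ ⊆ E → Φ g = Φ h →
      (g.1 : TreeAut X ⧸ finitary X) = h.1 := by
    intro g h hg hh H
    have hsec : ∀ x : Ray X, ∃ n, sect g.1⁻¹ (x n) = sect h.1⁻¹ (x n) := by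
      intro x
      by_cases hx : x ∈ E
      · refine exists_sect_eq hd (hoff _ (inv_mem g.2) x) (hoff _ (inv_mem h.2) x) ?_
        filter_upwards [hcode _ (inv_mem g.2) x, hcode _ (inv_mem h.2) x] with n h1 h2
        rw [h1, h2]
        exact congrFun (congrFun H ⟨x, hx⟩) (τ n)
      · obtain ⟨n, h1, h2⟩ := ((eventually_sect_eq_one fun h => hx (hg h)).and
          (eventually_sect_eq_one fun h => hx (hh h))).exists
        exact ⟨n, h1.trans h2.symm⟩
    rw [QuotientGroup.eq, mem_finitary]
    refine exists_trivialFrom_of_singular_eq_empty (Set.eq_empty_of_forall_notMem fun y hy => ?_)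
    obtain ⟨n, hn⟩ := hsec (h.1 • y)
    refine hy n ?_
    rw [sect_mul, ← Ray.smul_apply, hn, Ray.smul_apply, sect_inv, inv_mul_cancel]
  let A : Set (Subgroup.closure T) := {g | singular g.1⁻¹ ⊆ E}
  -- On `A` the coset factors through `Φ`; the value 1 is only a filler for codes that do not occur.
  have hfac : (fun g : Subgroup.closure T => (g.1 : TreeAut X ⧸ finitary X)) '' A ⊆
      (fun φ => if h : ∃ g ∈ A, Φ g = φ then (h.choose.1 : TreeAut X ⧸ finitary X) else
        ((1 : TreeAut X) : TreeAut X ⧸ finitary X)) '' Set.univ := by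
    rintro _ ⟨g, hg, rfl⟩
    have h : ∃ g' ∈ A, Φ g' = Φ g := ⟨g, hg, rfl⟩
    refine ⟨Φ g, trivial, ?_⟩
    simp only [dif_pos h]
    exact key _ _ h.choose_spec.1 hg h.choose_spec.2
  refine ((Set.finite_univ.image _).subset hfac).subset ?_
  rintro _ ⟨g, ⟨hg, hgE⟩, rfl⟩
  exact ⟨⟨g, hg⟩, hgE, rfl⟩

end TreeAut

/-! ### Means and their limits. -/

/-- A finitely additive probability defined on all subsets of `Y`. -/
structure IsMean {Y : Type*} (μ : Set Y → ℝ) : Prop where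
  mem_Icc : ∀ A, 0 ≤ μ A ∧ μ A ≤ 1
  union : ∀ A B, Disjoint A B → μ (A ∪ B) = μ A + μ B
  univ : μ Set.univ = 1

namespace IsMean

variable {Y Z : Type*}

theorem preimage {μ : Set Y → ℝ} (hμ : IsMean μ) (f : Y → Z) :
    IsMean fun A : Set Z => μ (f ⁻¹' A) where
  mem_Icc A := hμ.mem_Icc _
  union A B h := by rw [Set.preimage_union, hμ.union _ _ (h.preimage f)]
  univ := hμ.univ

/-- A convex combination of means is a mean. -/
theorem sum {ι : Type*} (s : Finset ι) (w : ι → ℝ) (hw : ∀ i ∈ s, 0 ≤ w i)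
    (hw1 : ∑ i ∈ s, w i = 1) (μ : ι → Set Y → ℝ) (hμ : ∀ i ∈ s, IsMean (μ i)) :
    IsMean fun A => ∑ i ∈ s, w i * μ i A where
  mem_Icc A := by
    refine ⟨Finset.sum_nonneg fun i hi => mul_nonneg (hw i hi) ((hμ i hi).mem_Icc A).1, ?_⟩
    rw [← hw1]
    exact Finset.sum_le_sum fun i hi => mul_le_of_le_one_right (hw i hi) ((hμ i hi).mem_Icc A).2
  union A B h := by
    rw [← Finset.sum_add_distrib]
    exact Finset.sum_congr rfl fun i hi => by rw [(hμ i hi).union A B h, mul_add]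
  univ := by
    rw [← hw1]
    exact Finset.sum_congr rfl fun i hi => by rw [(hμ i hi).univ, mul_one]

theorem average {ι : Type*} {s : Finset ι} (hs : s.Nonempty) (μ : ι → Set Y → ℝ)
    (hμ : ∀ i ∈ s, IsMean (μ i)) : IsMean fun A => ∑ i ∈ s, (s.card : ℝ)⁻¹ * μ i A :=
  sum s _ (fun _ _ => by positivity) (by
    rw [Finset.sum_const, nsmul_eq_mul, mul_inv_cancel₀]
    exact_mod_cast hs.card_pos.ne') μ hμ

theorem dirac (y : Y) [∀ A : Set Y, Decidable (y ∈ A)] :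
    IsMean fun A : Set Y => if y ∈ A then 1 else 0 where
  mem_Icc A := by split_ifs <;> norm_num
  union A B h := by
    have hd : y ∈ A → y ∉ B := fun hA => Set.disjoint_left.mp h hA
    by_cases h1 : y ∈ A <;> by_cases h2 : y ∈ B <;> simp_all
  univ := by simp

/-- A limit along an ultrafilter of a family of means, which satisfies all the relations that the
family satisfies asymptotically. -/
theorem exists_limit {ι : Type*} {l : Filter ι} [l.NeBot] {μ : ι → Set Y → ℝ}
    (hμ : ∀ i, IsMean (μ i)) : ∃ ν : Set Y → ℝ, IsMean ν ∧
      ∀ A B, Filter.Tendsto (fun i => μ i A - μ i B) l (nhds 0) → ν A = ν B := by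
  let U := Ultrafilter.of l
  have hlim : ∀ A, ∃ a ∈ Set.Icc (0 : ℝ) 1, Filter.Tendsto (fun i => μ i A) U (nhds a) := by
    intro A
    have := (isCompact_Icc (a := (0 : ℝ)) (b := 1)).ultrafilter_le_nhds
      (U.map fun i => μ i A) (by
        rw [Filter.le_principal_iff]
        exact Filter.mem_map.2 (Filter.univ_mem' fun i => (hμ i).mem_Icc A))
    exact this
  choose ν hν hνt using hlim
  refine ⟨ν, ⟨hν, fun A B h => ?_, ?_⟩, fun A B h => ?_⟩
  · refine tendsto_nhds_unique (hνt (A ∪ B)) ?_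
    simpa only [(hμ _).union A B h] using (hνt A).add (hνt B)
  · refine tendsto_nhds_unique (hνt Set.univ) ?_
    simp only [(hμ _).univ]
    exact tendsto_const_nhds
  · have h1 := (hνt A).sub (hνt B)
    have h2 := tendsto_nhds_unique h1 (h.mono_left (Ultrafilter.of_le l))
    linarith

end IsMean

/-! ### Invariant means on groups and subgroups. -/

section Invariance

variable {Γ : Type*} [Group Γ]

/-- Approximately invariant means yield an invariant mean. -/
theorem exists_invariant_mean {S : Set Γ}
    (h : ∀ T : Finset Γ, (T : Set Γ) ⊆ S → ∀ ε > (0 : ℝ), ∃ μ : Set Γ → ℝ, IsMean μ ∧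
      ∀ s ∈ T, ∀ A, |μ ((fun x => s * x) '' A) - μ A| ≤ ε) :
    ∃ μ : Set Γ → ℝ, IsMean μ ∧ ∀ s ∈ S, ∀ A, μ ((fun x => s * x) '' A) = μ A := by
  classical
  have h' : ∀ p : Finset S × ℕ, ∃ μ : Set Γ → ℝ, IsMean μ ∧
      ∀ s ∈ p.1, ∀ A, |μ ((fun x => s.1 * x) '' A) - μ A| ≤ 1 / ((p.2 : ℝ) + 1) := by
    intro p
    obtain ⟨μ, hμ, hinv⟩ := h (p.1.map (Function.Embedding.subtype _)) (by
      intro x hx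
      obtain ⟨s, _, rfl⟩ := Finset.mem_map.1 (Finset.mem_coe.1 hx)
      exact s.2) (1 / ((p.2 : ℝ) + 1)) (by positivity)
    exact ⟨μ, hμ, fun s hs => hinv s.1 (Finset.mem_map_of_mem _ hs)⟩
  choose μ hμ hinv using h'
  obtain ⟨ν, hν, hlim⟩ := IsMean.exists_limit (l := Filter.atTop) hμ
  refine ⟨ν, hν, fun s hs A => hlim _ _ ?_⟩
  have h0 : Filter.Tendsto (fun p : Finset S × ℕ => 1 / ((p.2 : ℝ) + 1)) Filter.atTop (nhds 0) := by
    rw [← Filter.prod_atTop_atTop_eq]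
    exact tendsto_one_div_add_atTop_nhds_zero_nat.comp Filter.tendsto_snd
  refine squeeze_zero_norm' ?_ h0
  filter_upwards [Filter.eventually_ge_atTop (({⟨s, hs⟩} : Finset S), 0)] with p hp
  exact hinv p ⟨s, hs⟩ (hp.1 (Finset.mem_singleton_self _)) A

theorem invariant_closure {S : Set Γ} {μ : Set Γ → ℝ}
    (h : ∀ s ∈ S, ∀ A, μ ((fun x => s * x) '' A) = μ A) {g : Γ} (hg : g ∈ Subgroup.closure S) :
    ∀ A, μ ((fun x => g * x) '' A) = μ A := by
  induction hg using Subgroup.closure_induction with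
  | mem s hs => exact h s hs
  | one => intro A; simp
  | mul a b _ _ ha hb =>
    intro A
    have e : (fun x => a * b * x) '' A = (fun x => a * x) '' ((fun x => b * x) '' A) := by
      rw [← Set.image_comp]
      exact Set.image_congr fun x _ => mul_assoc a b x
    rw [e, ha, hb]
  | inv a _ ha =>
    intro A
    rw [← ha, ← Set.image_comp]
    simp

/-- A subgroup is amenable if it preserves a mean on the whole group. -/
theorem isAmenableGroup_of_invariant {H : Subgroup Γ} {μ : Set Γ → ℝ} (hμ : IsMean μ)
    (h : ∀ g ∈ H, ∀ A, μ ((fun x => g * x) '' A) = μ A) : IsAmenableGroup H := by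
  -- A transversal of the right cosets `H x` gives the `H`-equivariant map `x ↦ x * (rep x)⁻¹` onto
  -- `H`, along which the mean is pushed forward.
  let rep : Γ → Γ := fun x => (Quotient.mk (QuotientGroup.rightRel H) x).out
  have hrep : ∀ x, x * (rep x)⁻¹ ∈ H := fun x =>
    QuotientGroup.rightRel_apply.1 (Quotient.exact (Quotient.out_eq _))
  have hrep' : ∀ g ∈ H, ∀ x, rep (g * x) = rep x := fun g hg x => by
    refine congrArg Quotient.out (Quotient.sound ?_)
    change QuotientGroup.rightRel H _ _
    rw [QuotientGroup.rightRel_apply, mul_inv_rev, mul_inv_cancel_left]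
    exact H.inv_mem hg
  let π : Γ → H := fun x => ⟨x * (rep x)⁻¹, hrep x⟩
  have hπ : ∀ (g : H) x, π (g * x) = g * π x := fun g x =>
    Subtype.ext (by simp only [π, hrep' g g.2, mul_assoc, Subgroup.coe_mul])
  have hm := hμ.preimage π
  refine ⟨_, hm.mem_Icc, hm.union, hm.univ, fun g A => ?_⟩
  rw [← h g g.2 (π ⁻¹' A)]
  congr 1
  ext x
  constructor
  · rintro ⟨a, ha, hx⟩
    refine ⟨g⁻¹ * x, ?_, mul_inv_cancel_left _ _⟩
    have : π (g⁻¹ * x) = g⁻¹ * π x := hπ g⁻¹ x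
    rw [Set.mem_preimage, this, ← hx]
    simpa using ha
  · rintro ⟨y, hy, rfl⟩
    exact ⟨π y, hy, (hπ g y).symm⟩

/-- The union of an increasing sequence of finite subgroups preserves a mean. -/
theorem exists_invariant_mean_of_finite (K : ℕ → Subgroup Γ) (hK : Monotone K)
    [∀ n, Finite (K n)] : ∃ μ : Set Γ → ℝ, IsMean μ ∧
      ∀ g ∈ ⨆ n, K n, ∀ A, μ ((fun x => g * x) '' A) = μ A := by
  classical
  have := fun n => Fintype.ofFinite (K n)
  let μ : ℕ → Set Γ → ℝ := fun n A => ∑ k : K n,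
    ((Finset.univ : Finset (K n)).card : ℝ)⁻¹ * if k.1 ∈ A then 1 else 0
  have hμ : ∀ n, IsMean (μ n) := fun n =>
    IsMean.average Finset.univ_nonempty _ fun k _ => IsMean.dirac k.1
  obtain ⟨ν, hν, hlim⟩ := IsMean.exists_limit (l := Filter.atTop) hμ
  refine ⟨ν, hν, fun g hg A => hlim _ _ ?_⟩
  obtain ⟨m, hm⟩ := (Subgroup.mem_iSup_of_directed hK.directed_le).1 hg
  refine tendsto_const_nhds.congr' ?_
  filter_upwards [Filter.eventually_ge_atTop m] with n hn
  have hgn : g ∈ K n := hK hn hm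
  rw [eq_comm, sub_eq_zero]
  refine (Fintype.sum_equiv (Equiv.mulLeft (⟨g, hgn⟩ : K n)) _ _ fun k => ?_).symm
  congr 2
  simp

end Invariance

/-! ### Independent random subsets as squares of product unit vectors. -/

namespace ProductVector

variable {Y : Type*} [DecidableEq Y]

/-- The value at `E ⊆ V` of the tensor product over `x ∈ V` of the unit vectors with coordinates
`sin (θ x)` (at `x ∈ E`) and `cos (θ x)` (at `x ∉ E`). -/
noncomputable def amplitude (θ : Y → ℝ) (V E : Finset Y) : ℝ :=
  ∏ x ∈ V, if x ∈ E then Real.sin (θ x) else Real.cos (θ x)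

theorem amplitude_eq (θ : Y → ℝ) {V E : Finset Y} (hE : E ⊆ V) :
    amplitude θ V E = (∏ x ∈ E, Real.sin (θ x)) * ∏ x ∈ V \ E, Real.cos (θ x) := by
  rw [amplitude, ← Finset.prod_sdiff hE, mul_comm]
  congr 1
  · exact Finset.prod_congr rfl fun x hx => if_pos hx
  · exact Finset.prod_congr rfl fun x hx => if_neg (Finset.mem_sdiff.1 hx).2

theorem sum_amplitude_mul (θ η : Y → ℝ) (V : Finset Y) :
    ∑ E ∈ V.powerset, amplitude θ V E * amplitude η V E = ∏ x ∈ V, Real.cos (θ x - η x) := by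
  have h : ∀ x ∈ V, Real.cos (θ x - η x) =
      Real.sin (θ x) * Real.sin (η x) + Real.cos (θ x) * Real.cos (η x) := fun x _ => by
    rw [Real.cos_sub, add_comm]
  rw [Finset.prod_congr rfl h, Finset.prod_add]
  refine Finset.sum_congr rfl fun E hE => ?_
  rw [amplitude_eq θ (Finset.mem_powerset.1 hE), amplitude_eq η (Finset.mem_powerset.1 hE),
    Finset.prod_mul_distrib, Finset.prod_mul_distrib]
  ring

theorem sum_amplitude_sq (θ : Y → ℝ) (V : Finset Y) :
    ∑ E ∈ V.powerset, amplitude θ V E ^ 2 = 1 := by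
  simpa [← pow_two] using sum_amplitude_mul θ θ V

theorem amplitude_eq_zero_of_notMem {θ : Y → ℝ} {V E : Finset Y} {x : Y} (hxV : x ∈ V)
    (hx : x ∉ E) (hθ : θ x = Real.pi / 2) : amplitude θ V E = 0 :=
  Finset.prod_eq_zero hxV (by rw [if_neg hx, hθ, Real.cos_pi_div_two])

/-- The expectation of `φ` for the random subset of `V` whose distribution is the square of the
amplitude. -/
noncomputable def expect (θ : Y → ℝ) (V : Finset Y) (φ : Finset Y → ℝ) : ℝ :=
  ∑ E ∈ V.powerset, amplitude θ V E ^ 2 * φ E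

/-- A point with angle 0 is almost surely not chosen. -/
theorem expect_mono {θ : Y → ℝ} {V V' : Finset Y} (hV : V ⊆ V') (hθ : ∀ x, x ∉ V → θ x = 0)
    (φ : Finset Y → ℝ) : expect θ V' φ = expect θ V φ := by
  rw [expect, expect]
  refine (Finset.sum_subset_zero_on_sdiff (Finset.powerset_mono.2 hV) ?_ ?_).symm
  · intro E hE
    rw [Finset.mem_sdiff, Finset.mem_powerset, Finset.mem_powerset] at hE
    obtain ⟨x, hx, hxV⟩ := Finset.not_subset.1 hE.2
    rw [amplitude, Finset.prod_eq_zero (hE.1 hx) (by rw [if_pos hx, hθ x hxV, Real.sin_zero])]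
    ring
  · intro E hE
    congr 2
    refine Finset.prod_subset hV fun x _ hxV => ?_
    rw [if_neg fun h => hxV (Finset.mem_powerset.1 hE h), hθ x hxV, Real.cos_zero]

theorem expect_map (e : Equiv.Perm Y) (θ : Y → ℝ) (V : Finset Y) (φ : Finset Y → ℝ) :
    expect θ V (fun E => φ (E.map e.toEmbedding)) =
      expect (fun x => θ (e.symm x)) (V.map e.toEmbedding) φ := by
  rw [expect, expect]
  refine Finset.sum_bij (fun E _ => E.map e.toEmbedding) ?_ ?_ ?_ ?_
  · intro E hE
    exact Finset.mem_powerset.2 (Finset.map_subset_map.2 (Finset.mem_powerset.1 hE))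
  · intro E _ E' _ h
    exact Finset.map_injective _ h
  · intro E hE
    refine ⟨E.map e.symm.toEmbedding, ?_, ?_⟩
    · rw [Finset.mem_powerset, ← Finset.map_subset_map (f := e.toEmbedding)]
      convert Finset.mem_powerset.1 hE
      ext; simp
    · ext; simp
  · intro E _
    rw [amplitude, amplitude, Finset.prod_map]
    simp

theorem one_sub_prod_le {ι : Type*} (s : Finset ι) (c : ι → ℝ) (h0 : ∀ i ∈ s, 0 ≤ c i)
    (h1 : ∀ i ∈ s, c i ≤ 1) : 1 - ∏ i ∈ s, c i ≤ ∑ i ∈ s, (1 - c i) := by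
  classical
  induction s using Finset.induction_on with
  | empty => simp
  | insert a s ha ih =>
    rw [Finset.prod_insert ha, Finset.sum_insert ha]
    have := ih (fun i hi => h0 i (Finset.mem_insert_of_mem hi))
      (fun i hi => h1 i (Finset.mem_insert_of_mem hi))
    have hp : ∏ i ∈ s, c i ≤ 1 := Finset.prod_le_one
      (fun i hi => h0 i (Finset.mem_insert_of_mem hi))
      (fun i hi => h1 i (Finset.mem_insert_of_mem hi))
    have := h0 a (Finset.mem_insert_self a s)
    have := h1 a (Finset.mem_insert_self a s)
    nlinarith

/-- The distribution of the random subset depends continuously on `θ` in the `ℓ²`-norm. -/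
theorem abs_expect_sub_le {θ η : Y → ℝ} (V : Finset Y)
    (hθ : ∀ x, 0 ≤ θ x ∧ θ x ≤ Real.pi / 2) (hη : ∀ x, 0 ≤ η x ∧ η x ≤ Real.pi / 2)
    {φ : Finset Y → ℝ} (hφ : ∀ E, |φ E| ≤ 1) :
    |expect θ V φ - expect η V φ| ≤ 2 * √(∑ x ∈ V, (θ x - η x) ^ 2) := by
  set f := amplitude θ V
  set h := amplitude η V
  set I := ∑ E ∈ V.powerset, f E * h E with hI
  have hf : ∑ E ∈ V.powerset, f E ^ 2 = 1 := sum_amplitude_sq θ V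
  have hh : ∑ E ∈ V.powerset, h E ^ 2 = 1 := sum_amplitude_sq η V
  -- Angles in `[0, π/2]` keep every factor of the inner product `I` in `[0, 1]`, so that `1 - I` is
  -- at most the sum of the defects.
  have hcos : ∀ x ∈ V, 0 ≤ Real.cos (θ x - η x) := fun x _ =>
    Real.cos_nonneg_of_neg_pi_div_two_le_of_le (by linarith [(hθ x).1, (hη x).2])
      (by linarith [(hθ x).2, (hη x).1])
  have hIle : I ≤ 1 := by
    rw [hI, sum_amplitude_mul]
    exact Finset.prod_le_one hcos fun x _ => Real.cos_le_one _
  have hIge : 1 - I ≤ (∑ x ∈ V, (θ x - η x) ^ 2) / 2 := by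
    rw [hI, sum_amplitude_mul, Finset.sum_div]
    refine (one_sub_prod_le V _ hcos fun x _ => Real.cos_le_one _).trans ?_
    refine Finset.sum_le_sum fun x _ => ?_
    linarith [Real.one_sub_sq_div_two_le_cos (x := θ x - η x)]
  have hminus : ∑ E ∈ V.powerset, |f E - h E| ^ 2 = 2 - 2 * I := by
    have : ∀ E ∈ V.powerset, |f E - h E| ^ 2 = f E ^ 2 + h E ^ 2 - 2 * (f E * h E) :=
      fun E _ => by rw [sq_abs]; ring
    rw [Finset.sum_congr rfl this, Finset.sum_sub_distrib, Finset.sum_add_distrib, hf, hh,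
      ← Finset.mul_sum]
    ring
  have hplus : ∑ E ∈ V.powerset, |f E + h E| ^ 2 = 2 + 2 * I := by
    have : ∀ E ∈ V.powerset, |f E + h E| ^ 2 = f E ^ 2 + h E ^ 2 + 2 * (f E * h E) :=
      fun E _ => by rw [sq_abs]; ring
    rw [Finset.sum_congr rfl this, Finset.sum_add_distrib, Finset.sum_add_distrib, hf, hh,
      ← Finset.mul_sum]
    ring
  calc |expect θ V φ - expect η V φ|
      = |∑ E ∈ V.powerset, (f E ^ 2 - h E ^ 2) * φ E| := by
        rw [expect, expect, ← Finset.sum_sub_distrib]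
        simp only [sub_mul, f, h]
    _ ≤ ∑ E ∈ V.powerset, |f E - h E| * |f E + h E| := by
        refine (Finset.abs_sum_le_sum_abs _ _).trans (Finset.sum_le_sum fun E _ => ?_)
        rw [abs_mul, ← abs_mul (f E - h E), show (f E - h E) * (f E + h E) = f E ^ 2 - h E ^ 2 by
          ring]
        exact mul_le_of_le_one_right (abs_nonneg _) (hφ E)
    _ ≤ √(∑ E ∈ V.powerset, |f E - h E| ^ 2) * √(∑ E ∈ V.powerset, |f E + h E| ^ 2) :=
        Real.sum_mul_le_sqrt_mul_sqrt _ _ _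
    -- The squared norms are `2 - 2 * I` and `2 + 2 * I`, the latter at most 4.
    _ ≤ √(∑ x ∈ V, (θ x - η x) ^ 2) * √(2 ^ 2) := by
        rw [hminus, hplus]
        gcongr <;> linarith
    _ = 2 * √(∑ x ∈ V, (θ x - η x) ^ 2) := by
        rw [Real.sqrt_sq (by norm_num), mul_comm]

end ProductVector

/-! ### Recurrence: functions of small energy on rays. -/

/-- Finite sets `W n` that all contain `F`, whose boundaries have bounded size and such that every
point lies in finitely many of the boundaries yield finitely supported functions that are equal to
one on `F` and have arbitrarily small energy. -/
theorem exists_small_energy {Y : Type*} {T : Set (Equiv.Perm Y)} (hT : T.Finite) {F : Set Y}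
    {W : ℕ → Set Y} (hWfin : ∀ n, (W n).Finite) (hFW : ∀ n, F ⊆ W n) {M : ℕ}
    (hM : ∀ s ∈ T, ∀ n, ∀ V : Finset Y, (∀ y ∈ V, ¬ (y ∈ W n ↔ s y ∈ W n)) → V.card ≤ M)
    (hev : ∀ s ∈ T, ∀ y, ∀ᶠ n in Filter.atTop, (y ∈ W n ↔ s y ∈ W n))
    {ε : ℝ} (hε : 0 < ε) :
    ∃ (a : Y → ℝ) (V₀ : Finset Y), (∀ y, 0 ≤ a y ∧ a y ≤ 1) ∧ (∀ y, y ∉ V₀ → a y = 0) ∧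
      (∀ y ∈ F, a y = 1) ∧ ∀ s ∈ T, ∀ V : Finset Y, ∑ y ∈ V, (a (s y) - a y) ^ 2 ≤ ε := by
  classical
  have step : ∀ L : ℕ, ∃ (a : Y → ℝ) (V₀ : Finset Y), (∀ y, 0 ≤ a y ∧ a y ≤ L) ∧
      (∀ y, y ∉ V₀ → a y = 0) ∧ (∀ y ∈ F, a y = L) ∧
      ∀ s ∈ T, ∀ V : Finset Y, ∑ y ∈ V, (a (s y) - a y) ^ 2 ≤ L * M := by
    intro L
    induction L with
    | zero => exact ⟨fun _ => 0, ∅, by simp, by simp, by simp, by simp⟩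
    | succ L ih =>
      obtain ⟨a, V₀, ha, haV, haF, haE⟩ := ih
      -- Far out, the boundary of `W n` avoids the finite set where `a` varies along `s`, so adding
      -- the indicator of `W n` adds energies without a cross term.
      have hdis : ∀ s ∈ T, ∀ᶠ n in Filter.atTop, ∀ y, a (s y) - a y ≠ 0 →
          (y ∈ W n ↔ s y ∈ W n) := by
        intro s hs
        have hfin : {y | a (s y) - a y ≠ 0}.Finite := by
          refine (V₀.finite_toSet.union
            (V₀.finite_toSet.preimage (f := s) s.injective.injOn)).subset fun y hy => ?_
          by_contra hn
          simp only [Set.mem_union, Set.mem_preimage, Finset.mem_coe, not_or] at hn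
          exact hy (by rw [haV _ hn.1, haV _ hn.2, sub_zero])
        exact (hfin.eventually_all).2 fun y _ => hev s hs y
      obtain ⟨n, hn⟩ := ((hT.eventually_all).2 hdis).exists
      refine ⟨fun y => a y + if y ∈ W n then 1 else 0, V₀ ∪ (hWfin n).toFinset, fun y => ?_,
        fun y hy => ?_, fun y hy => ?_, fun s hs V => ?_⟩
      · have := ha y
        push_cast
        split_ifs <;> constructor <;> linarith
      · simp only [Finset.mem_union, Set.Finite.mem_toFinset, not_or] at hy
        simp only [haV y hy.1, if_neg hy.2, add_zero]
      · simp only [haF y hy, if_pos (hFW n hy), Nat.cast_succ]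
      · have hpt : ∀ y ∈ V, ((a (s y) + if s y ∈ W n then 1 else 0) -
            (a y + if y ∈ W n then 1 else 0)) ^ 2 =
            (a (s y) - a y) ^ 2 + if ¬ (y ∈ W n ↔ s y ∈ W n) then 1 else 0 := by
          intro y _
          by_cases h : (y ∈ W n ↔ s y ∈ W n)
          · simp only [h, not_true_eq_false, if_false]
            ring
          · have h0 : a (s y) - a y = 0 := by
              by_contra h'
              exact h (hn s hs y h')
            rw [if_pos h, h0, sub_eq_zero.1 h0]
            by_cases h1 : y ∈ W n <;> by_cases h2 : s y ∈ W n <;> simp_all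
        rw [Finset.sum_congr rfl hpt, Finset.sum_add_distrib, Finset.sum_boole]
        have h1 := haE s hs V
        have h2 : ((V.filter fun y => ¬ (y ∈ W n ↔ s y ∈ W n)).card : ℝ) ≤ M := by
          exact_mod_cast hM s hs n _ fun y hy => (Finset.mem_filter.1 hy).2
        push_cast
        linarith
  -- Dividing the sum of `L` indicators by `L` leaves energy at most `L * M / L ^ 2 = M / L`.
  obtain ⟨L, hL⟩ := exists_nat_gt ((M : ℝ) / ε)
  have hL0 : (0 : ℝ) < L := lt_of_le_of_lt (by positivity) hL
  obtain ⟨a, V₀, ha, haV, haF, haE⟩ := step L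
  refine ⟨fun y => a y / L, V₀, fun y => ⟨div_nonneg (ha y).1 hL0.le,
    div_le_one_of_le₀ (ha y).2 hL0.le⟩, fun y hy => by simp only [haV y hy, zero_div],
    fun y hy => by simp only [haF y hy, div_self hL0.ne'], fun s hs V => ?_⟩
  have h1 : ∀ y ∈ V, (a (s y) / L - a y / L) ^ 2 = (a (s y) - a y) ^ 2 / (L : ℝ) ^ 2 :=
    fun y _ => by rw [← sub_div, div_pow]
  rw [Finset.sum_congr rfl h1, ← Finset.sum_div, div_le_iff₀ (by positivity)]
  refine (haE s hs V).trans ?_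
  rw [div_lt_iff₀ hε] at hL
  nlinarith

namespace Ray

variable {X : Type*}

/-- The rays that differ from `q` only in their first `n` letters. -/
def tile (n : ℕ) (q : Ray X) : Set (Ray X) := {y | ∀ k, (y (n + k)).drop n = (q (n + k)).drop n}

theorem mem_tile_self (n : ℕ) (q : Ray X) : q ∈ tile n q := fun _ => rfl

theorem injOn_tile (n : ℕ) (q : Ray X) : Set.InjOn (fun y : Ray X => y n) (tile n q) := by
  intro y hy z hz h
  refine Ray.ext fun k => eq_of_le (Nat.le_add_left k n) ?_
  rw [← append_drop y n k, ← append_drop z n k, hy k, hz k]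
  exact congrArg (· ++ _) h

theorem finite_tile [Finite X] (n : ℕ) (q : Ray X) : (tile n q).Finite := by
  refine Set.Finite.of_finite_image ((TreeAut.finite_length_eq n).subset ?_) (injOn_tile n q)
  rintro _ ⟨y, _, rfl⟩
  exact y.length_apply n

theorem smul_mem_tile_iff {n : ℕ} {q y : Ray X} {s : TreeAut X} (h : TreeAut.sect s (y n) = 1) :
    s • y ∈ tile n q ↔ y ∈ tile n q := by
  have e : ∀ k, ((s • y) (n + k)).drop n = (y (n + k)).drop n := by
    intro k
    rw [smul_apply, ← append_drop y n k, TreeAut.apply_append_sect, h,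
      List.drop_left' (by rw [TreeAut.length_apply, length_apply]),
      List.drop_left' (length_apply y n)]
    rfl
  simp only [tile, Set.mem_ofPred_eq, e]

end Ray

namespace TreeAut

variable {X : Type*}

/-- A boundary point `y` has a nontrivial section at `y n`, and `y` or `s • y` lies in one of the
tiles. Points of a tile have distinct vertices at level `n`, so each tile accounts for at most `C`
points of either kind. -/
theorem card_boundary_le [Finite X] {s : TreeAut X} {C n : ℕ} (hC : activity s n ≤ C)
    (Q : Finset (Ray X)) {V : Finset (Ray X)}
    (hV : ∀ y ∈ V, ¬ (y ∈ ⋃ q ∈ Q, Ray.tile n q ↔ s • y ∈ ⋃ q ∈ Q, Ray.tile n q)) :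
    V.card ≤ Q.card * (C + C) := by
  classical
  let A := fun q => V.filter fun y => sect s (y n) ≠ 1 ∧ y ∈ Ray.tile n q
  let B := fun q => V.filter fun y => sect s (y n) ≠ 1 ∧ s • y ∈ Ray.tile n q
  have hA : ∀ q, (A q).card ≤ C := fun q =>
    (card_le_activity (fun y hy => (Finset.mem_filter.1 hy).2.1)
      ((Ray.injOn_tile n q).mono fun y hy => (Finset.mem_filter.1 hy).2.2)).trans hC
  have hB : ∀ q, (B q).card ≤ C := fun q =>
    (card_le_activity (fun y hy => (Finset.mem_filter.1 hy).2.1) (fun y hy z hz h =>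
      smul_left_cancel s (Ray.injOn_tile n q (Finset.mem_filter.1 hy).2.2
        (Finset.mem_filter.1 hz).2.2 (congrArg s.1 h)))).trans hC
  refine (Finset.card_le_card (t := Q.biUnion fun q => A q ∪ B q) fun y hy => ?_).trans
    (Finset.card_biUnion_le_card_mul _ _ _ fun q _ =>
      (Finset.card_union_le _ _).trans (add_le_add (hA q) (hB q)))
  have h1 := hV y hy
  have h2 : sect s (y n) ≠ 1 := fun h => h1 (by
    simp only [Set.mem_iUnion, Ray.smul_mem_tile_iff h])
  have h3 : y ∈ ⋃ q ∈ Q, Ray.tile n q ∨ s • y ∈ ⋃ q ∈ Q, Ray.tile n q := by tauto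
  simp only [Set.mem_iUnion, exists_prop] at h3
  simp only [A, B, Finset.mem_biUnion, Finset.mem_union, Finset.mem_filter]
  rcases h3 with ⟨q, hq, h⟩ | ⟨q, hq, h⟩
  · exact ⟨q, hq, Or.inl ⟨hy, h2, h⟩⟩
  · exact ⟨q, hq, Or.inr ⟨hy, h2, h⟩⟩

/-- The action of bounded automorphisms on rays is recurrent: there are finitely supported functions
of arbitrarily small energy that are equal to one at all singular rays. -/
theorem exists_small_energy_singular [Finite X] (T : Finset (TreeAut X))
    (hT : ∀ s ∈ T, IsBounded s) {ε : ℝ} (hε : 0 < ε) :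
    ∃ (a : Ray X → ℝ) (V₀ : Finset (Ray X)), (∀ y, 0 ≤ a y ∧ a y ≤ 1) ∧
      (∀ y, y ∉ V₀ → a y = 0) ∧ (∀ s ∈ T, ∀ y ∈ singular s, a y = 1) ∧
      ∀ s ∈ T, ∀ V : Finset (Ray X), ∑ y ∈ V, (a (s • y) - a y) ^ 2 ≤ ε := by
  classical
  have hfin : (⋃ s ∈ T, singular s).Finite :=
    T.finite_toSet.biUnion fun s hs => (hT s hs).finite_singular
  have hfin' : (⋃ s ∈ T, (fun y => s • y) '' singular s).Finite :=
    T.finite_toSet.biUnion fun s hs => (hT s hs).finite_singular.image _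
  -- The images are included so that a singular ray and its image lie in every `W n`; it is then
  -- never a boundary point.
  let Q : Finset (Ray X) := hfin.toFinset ∪ hfin'.toFinset
  have hQ : ∀ s ∈ T, ∀ y ∈ singular s, y ∈ Q ∧ s • y ∈ Q := by
    intro s hs y hy
    simp only [Q, Finset.mem_union, Set.Finite.mem_toFinset, Set.mem_iUnion, exists_prop]
    exact ⟨Or.inl ⟨s, hs, hy⟩, Or.inr ⟨s, hs, y, hy, rfl⟩⟩
  let W : ℕ → Set (Ray X) := fun n => ⋃ q ∈ Q, Ray.tile n q
  have hQW : ∀ n, ∀ q ∈ Q, q ∈ W n := fun n q hq =>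
    Set.mem_iUnion₂.2 ⟨q, hq, Ray.mem_tile_self n q⟩
  choose! C hC using hT
  obtain ⟨M, hM⟩ : ∃ M, ∀ s ∈ T, C s ≤ M := ⟨T.sup C, fun s hs => Finset.le_sup hs⟩
  obtain ⟨a, V₀, h1, h2, h3, h4⟩ := exists_small_energy (F := ⋃ s ∈ T, singular s) (W := W)
    (M := Q.card * (M + M)) (T.finite_toSet.image (fun s => MulAction.toPerm (α := TreeAut X) s))
    (fun n => Q.finite_toSet.biUnion fun q _ => Ray.finite_tile n q)
    (fun n y hy => by
      obtain ⟨s, hs, hy⟩ := Set.mem_iUnion₂.1 hy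
      exact hQW n y (hQ s hs y hy).1)
    (by
      rintro _ ⟨s, hs, rfl⟩ n V hV
      exact card_boundary_le ((hC s hs n).trans (hM s hs)) Q hV)
    (by
      rintro _ ⟨s, hs, rfl⟩ y
      by_cases hy : y ∈ singular s
      · exact Filter.Eventually.of_forall fun n =>
          iff_of_true (hQW n _ (hQ s hs y hy).1) (hQW n _ (hQ s hs y hy).2)
      · filter_upwards [eventually_sect_eq_one hy] with n hn
        simp only [W, Set.mem_iUnion, MulAction.toPerm_apply, Ray.smul_mem_tile_iff hn])
    hε
  exact ⟨a, V₀, h1, h2, fun s hs y hy => h3 y (Set.mem_iUnion₂.2 ⟨s, hs, hy⟩),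
    fun s hs V => h4 _ ⟨s, hs, rfl⟩ V⟩

end TreeAut

/-! ### Translating an invariant mean to cosets. -/

section CosetMean

variable {Γ : Type*} [Group Γ] {N : Subgroup Γ}

/-- The translate of `lam` to a left coset of `N`. -/
noncomputable def cosetMean (lam : Set Γ → ℝ) (c : Γ ⧸ N) (A : Set Γ) : ℝ :=
  lam ((fun x => c.out * x) ⁻¹' A)

/-- The representatives of `s • c` and `s * c.out` differ on the right by an element of `N`, which
`lam` absorbs. -/
theorem cosetMean_smul {lam : Set Γ → ℝ} (hinv : ∀ g ∈ N, ∀ A, lam ((fun x => g * x) '' A) = lam A)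
    (s : Γ) (c : Γ ⧸ N) (A : Set Γ) :
    cosetMean lam (s • c) ((fun x => s * x) '' A) = cosetMean lam c A := by
  obtain ⟨n, hn⟩ := QuotientGroup.mk_out_eq_mul N (s * c.out)
  have hc : ((s * c.out : Γ) : Γ ⧸ N) = s • c := by
    conv_rhs => rw [← QuotientGroup.out_eq' c]
    rfl
  rw [hc] at hn
  rw [cosetMean, cosetMean, hn,
    ← hinv _ (N.inv_mem n.2) ((fun x => c.out * x) ⁻¹' A)]
  congr 1
  ext x
  simp [mul_assoc]

/-- The average of the translates of `lam` to the cosets in a finite set. -/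
noncomputable def averageMean (lam : Set Γ → ℝ) (O : Finset (Γ ⧸ N)) (A : Set Γ) : ℝ :=
  ∑ c ∈ O, (O.card : ℝ)⁻¹ * cosetMean lam c A

theorem IsMean.averageMean {lam : Set Γ → ℝ} (hlam : IsMean lam) {O : Finset (Γ ⧸ N)}
    (hO : O.Nonempty) : IsMean (averageMean lam O) :=
  IsMean.average hO _ fun _ _ => hlam.preimage _

theorem averageMean_smul {lam : Set Γ → ℝ}
    (hinv : ∀ g ∈ N, ∀ A, lam ((fun x => g * x) '' A) = lam A) {s : Γ} {O O' : Finset (Γ ⧸ N)}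
    (hO : (fun c => s • c) '' (O : Set (Γ ⧸ N)) = O') (A : Set Γ) :
    averageMean lam O' ((fun x => s * x) '' A) = averageMean lam O A := by
  classical
  have h : O' = O.map (MulAction.toPerm s : Equiv.Perm (Γ ⧸ N)).toEmbedding := by
    rw [← Finset.coe_inj, ← hO, Finset.coe_map]
    rfl
  rw [averageMean, averageMean, h, Finset.sum_map, Finset.card_map]
  exact Finset.sum_congr rfl fun c _ => congrArg _ (cosetMean_smul hinv s c A)

end CosetMean

/-! ### Assembling the invariant mean. -/

namespace TreeAut

variable {X : Type*}

theorem exists_mean_finitary_invariant [Finite X] : ∃ lam : Set (TreeAut X) → ℝ, IsMean lam ∧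
    ∀ g ∈ finitary X, ∀ A, lam ((fun x => g * x) '' A) = lam A :=
  have := finite_finitaryLevel (X := X)
  exists_invariant_mean_of_finite (finitaryLevel X) finitaryLevel_mono

open ProductVector in
theorem exists_approximately_invariant_mean [Finite X] (T : Finset (TreeAut X))
    (hfs : ∀ s ∈ T, IsFiniteState s) (hb : ∀ s ∈ T, IsBounded s) {ε : ℝ} (hε : 0 < ε) :
    ∃ μ : Set (TreeAut X) → ℝ, IsMean μ ∧
      ∀ s ∈ T, ∀ A, |μ ((fun x => s * x) '' A) - μ A| ≤ ε := by
  classical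
  obtain ⟨lam, hlam, hinv⟩ := exists_mean_finitary_invariant (X := X)
  let G := Subgroup.closure (T : Set (TreeAut X))
  have hO : ∀ E : Finset (Ray X), (cosetsOver G (E : Set (Ray X))).Finite := fun E =>
    finite_cosetsOver T.finite_toSet hfs (fun s hs => (hb s hs).finite_singular) E.finite_toSet
  let u : Finset (Ray X) → Set (TreeAut X) → ℝ := fun E => averageMean lam (hO E).toFinset
  have hu : ∀ E, IsMean (u E) := fun E =>
    hlam.averageMean ((hO E).toFinset_nonempty.2 (cosetsOver_nonempty G E))
  -- The scaling `θ = π/2 * a` turns energy `(ε/π)²` into `(ε/2)²`, and `2 * √` of that is `ε`.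
  obtain ⟨a, V₀, ha, haV, haF, haE⟩ := exists_small_energy_singular T hb
    (ε := (ε / Real.pi) ^ 2) (by positivity)
  let θ : Ray X → ℝ := fun x => Real.pi / 2 * a x
  have hpi := Real.pi_pos
  have hθ : ∀ x, 0 ≤ θ x ∧ θ x ≤ Real.pi / 2 := fun x =>
    ⟨mul_nonneg (by positivity) (ha x).1, mul_le_of_le_one_right (by positivity) (ha x).2⟩
  have hθV : ∀ x, x ∉ V₀ → θ x = 0 := fun x hx => by simp only [θ, haV x hx, mul_zero]
  refine ⟨fun A => expect θ V₀ fun E => u E A,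
    IsMean.sum _ _ (fun E _ => sq_nonneg _) (sum_amplitude_sq θ V₀) _ fun E _ => hu E,
    fun s hs A => ?_⟩
  let e : Equiv.Perm (Ray X) := MulAction.toPerm s
  let φ : Finset (Ray X) → ℝ := fun E => u E ((fun x => s * x) '' A)
  have hsV : ∀ x ∈ singular s, x ∈ V₀ := fun x hx => by
    by_contra h
    have := haV x h
    rw [haF s hs x hx] at this
    exact one_ne_zero this
  -- Sets missing a singular ray of `s` have amplitude zero, since the angle there is `π/2`; on all
  -- others translation by `s` is exact.
  have h1 : expect θ V₀ (fun E => u E A) = expect θ V₀ fun E => φ (E.map e.toEmbedding) := by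
    refine Finset.sum_congr rfl fun E _ => ?_
    by_cases hE : singular s ⊆ E
    · congr 1
      refine (averageMean_smul hinv ?_ A).symm
      rw [Set.Finite.coe_toFinset, Set.Finite.coe_toFinset,
        image_smul_cosetsOver (Subgroup.subset_closure hs) hE, Finset.coe_map]
      rfl
    · obtain ⟨x, hx, hxE⟩ := Set.not_subset.1 hE
      rw [amplitude_eq_zero_of_notMem (hsV x hx) hxE (by simp only [θ, haF s hs x hx, mul_one])]
      ring
  let V := V₀ ∪ V₀.map e.toEmbedding
  have h2 : expect θ V φ = expect θ V₀ φ := expect_mono Finset.subset_union_left hθV φ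
  have h3 : expect (fun x => θ (e.symm x)) V φ = expect θ V₀ fun E => φ (E.map e.toEmbedding) := by
    rw [expect_map]
    refine expect_mono Finset.subset_union_right (fun x hx => hθV _ fun h => hx ?_) φ
    exact Finset.mem_map.2 ⟨_, h, e.apply_symm_apply x⟩
  change |expect θ V₀ φ - expect θ V₀ _| ≤ ε
  rw [h1, ← h2, ← h3]
  refine (abs_expect_sub_le V hθ (fun x => hθ _) fun E => ?_).trans ?_
  · rw [abs_of_nonneg ((hu E).mem_Icc _).1]
    exact ((hu E).mem_Icc _).2
  · have h4 : ∑ x ∈ V, (θ x - θ (e.symm x)) ^ 2 ≤ (ε / 2) ^ 2 := by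
      have h5 := haE s hs (V.map e.symm.toEmbedding)
      rw [Finset.sum_map] at h5
      calc ∑ x ∈ V, (θ x - θ (e.symm x)) ^ 2
          = (Real.pi / 2) ^ 2 * ∑ x ∈ V, (a (e (e.symm x)) - a (e.symm x)) ^ 2 := by
            rw [Finset.mul_sum]
            refine Finset.sum_congr rfl fun x _ => ?_
            rw [e.apply_symm_apply, ← mul_pow, mul_sub]
        _ ≤ (Real.pi / 2) ^ 2 * (ε / Real.pi) ^ 2 := by
            gcongr
            exact h5
        _ = (ε / 2) ^ 2 := by
            field_simp
    calc 2 * √(∑ x ∈ V, (θ x - θ (e.symm x)) ^ 2) ≤ 2 * √((ε / 2) ^ 2) := by gcongr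
      _ = ε := by rw [Real.sqrt_sq (by positivity)]; ring

theorem isAmenableGroup_closure [Finite X] {S : Set (TreeAut X)}
    (hS : ∀ g ∈ S, IsFiniteState g ∧ IsBounded g) : IsAmenableGroup (Subgroup.closure S) := by
  obtain ⟨μ, hμ, hinv⟩ := exists_invariant_mean (S := S) fun T hT ε hε =>
    exists_approximately_invariant_mean T (fun s hs => (hS s (hT hs)).1)
      (fun s hs => (hS s (hT hs)).2) hε
  exact isAmenableGroup_of_invariant hμ fun g hg => invariant_closure hinv hg

end TreeAut

/-! ### Automata; the Grigorchuk and Basilica generators. -/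

namespace InvertibleAutomaton

variable {X Q : Type*}

/-- The state in which the automaton is after reading a word. -/
def state (A : InvertibleAutomaton X Q) (q : Q) (v : List X) : Q := v.foldl A.next q

theorem run_append (A : InvertibleAutomaton X Q) (q : Q) (v w : List X) :
    A.run q (v ++ w) = A.run q v ++ A.run (A.state q v) w := by
  induction v generalizing q with
  | nil => rfl
  | cons x v ih => exact congrArg (A.out q x :: ·) (ih (A.next q x))

theorem sect_toTreeAut (A : InvertibleAutomaton X Q) (q : Q) (v : List X) :
    TreeAut.sect (A.toTreeAut q) v = A.toTreeAut (A.state q v) :=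
  TreeAut.sect_eq_of_forall (A.run_append q v)

theorem isFiniteState_toTreeAut [Finite Q] (A : InvertibleAutomaton X Q) (q : Q) :
    TreeAut.IsFiniteState (A.toTreeAut q) := by
  refine (Set.finite_range A.toTreeAut).subset ?_
  rintro _ ⟨v, rfl⟩
  exact ⟨_, (A.sect_toTreeAut q v).symm⟩

theorem toTreeAut_eq_one (A : InvertibleAutomaton X Q) {e : Q} (hout : A.out e = 1)
    (hnext : ∀ x, A.next e x = e) : A.toTreeAut e = 1 := by
  refine TreeAut.ext_apply fun w => ?_
  change A.run e w = w
  induction w with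
  | nil => rfl
  | cons x w ih => rw [run, hout, hnext, ih]; rfl

/-- If the words leading to a nontrivial state are determined by their length up to finitely many
choices, then the automorphism is bounded. -/
theorem isBounded_toTreeAut (A : InvertibleAutomaton X Q) {e : Q} (he : A.toTreeAut e = 1)
    (q : Q) (u₁ u₂ : ℕ → List X) (h : ∀ v, A.state q v ≠ e → v = u₁ v.length ∨ v = u₂ v.length) :
    TreeAut.IsBounded (A.toTreeAut q) := by
  refine ⟨2, fun n => ?_⟩
  refine (Set.ncard_le_ncard (t := {u₁ n, u₂ n}) ?_ (Set.toFinite _)).trans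
    ((Set.ncard_insert_le _ _).trans (by rw [Set.ncard_singleton]))
  rintro v ⟨rfl, hv⟩
  refine h v fun hq => hv ?_
  rw [sect_toTreeAut, hq, he]

theorem state_eq_of_absorbing (A : InvertibleAutomaton X Q) {e : Q} (hnext : ∀ x, A.next e x = e)
    (v : List X) : A.state e v = e := by
  induction v with
  | nil => rfl
  | cons x v ih => rw [state, List.foldl_cons, hnext]; exact ih

end InvertibleAutomaton

instance : Finite GrigorchukState :=
  Finite.of_surjective (![.a, .b, .c, .d, .e] : Fin 5 → GrigorchukState) fun q => by
    cases q
    exacts [⟨0, rfl⟩, ⟨1, rfl⟩, ⟨2, rfl⟩, ⟨3, rfl⟩, ⟨4, rfl⟩]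

instance : Finite BasilicaState :=
  Finite.of_surjective (![.a, .b, .e] : Fin 3 → BasilicaState) fun q => by
    cases q
    exacts [⟨0, rfl⟩, ⟨1, rfl⟩, ⟨2, rfl⟩]

theorem grigorchukAutomaton_state_e (v : List (Fin 2)) : grigorchukAutomaton.state .e v = .e :=
  grigorchukAutomaton.state_eq_of_absorbing (fun _ => rfl) v

theorem basilicaAutomaton_state_e (v : List (Fin 2)) : basilicaAutomaton.state .e v = .e :=
  basilicaAutomaton.state_eq_of_absorbing (fun _ => rfl) v

theorem grigorchukAutomaton_state_a {v : List (Fin 2)}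
    (h : grigorchukAutomaton.state .a v ≠ .e) : v = [] := by
  cases v with
  | nil => rfl
  | cons x v => exact absurd (grigorchukAutomaton_state_e v) h

/-- Reading 0 leads to `a` or `e`, and `a` leads only to `e`; so a 0 can occur only as the last
letter. -/
theorem grigorchukAutomaton_active (v : List (Fin 2)) (q : GrigorchukState)
    (h : grigorchukAutomaton.state q v ≠ .e) :
    v = List.replicate v.length 1 ∨ v = List.replicate (v.length - 1) 1 ++ [0] := by
  induction v generalizing q with
  | nil => exact Or.inl rfl
  | cons x v ih =>
    have h' : grigorchukAutomaton.state (grigorchukAutomaton.next q x) v ≠ .e := h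
    fin_cases x
    · have hv : v = [] := by
        cases q
        · exact absurd (grigorchukAutomaton_state_e v) h'
        · exact grigorchukAutomaton_state_a h'
        · exact grigorchukAutomaton_state_a h'
        · exact absurd (grigorchukAutomaton_state_e v) h'
        · exact absurd (grigorchukAutomaton_state_e v) h'
      subst hv
      exact Or.inr rfl
    · change 1 :: v = List.replicate (v.length + 1) (1 : Fin 2) ∨
        1 :: v = List.replicate v.length 1 ++ [0]
      rcases ih _ h' with hv | hv
      · left
        rw [List.replicate_succ, ← hv]
      · right
        obtain ⟨m, hm⟩ : ∃ m, v.length = m + 1 := by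
          cases v with
          | nil => simp at hv
          | cons y v => exact ⟨v.length, rfl⟩
        rw [hm, Nat.add_sub_cancel] at hv
        rw [hm, List.replicate_succ, List.cons_append, ← hv]

/-- Reading 0 leads to `e` from every state, so only the letter 1 keeps the automaton active. -/
theorem basilicaAutomaton_active (v : List (Fin 2)) (q : BasilicaState)
    (h : basilicaAutomaton.state q v ≠ .e) : v = List.replicate v.length 1 := by
  induction v generalizing q with
  | nil => rfl
  | cons x v ih =>
    have h' : basilicaAutomaton.state (basilicaAutomaton.next q x) v ≠ .e := h
    fin_cases x
    · cases q <;> exact absurd (basilicaAutomaton_state_e v) h'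
    · rw [List.length_cons, List.replicate_succ, ← ih _ h']
      rfl

theorem grigorchukGenerators_finiteState_bounded :
    ∀ g ∈ grigorchukGenerators, TreeAut.IsFiniteState g ∧ TreeAut.IsBounded g := by
  have h : ∀ q, TreeAut.IsFiniteState (grigorchukAutomaton.toTreeAut q) ∧
      TreeAut.IsBounded (grigorchukAutomaton.toTreeAut q) := fun q =>
    ⟨grigorchukAutomaton.isFiniteState_toTreeAut q,
      grigorchukAutomaton.isBounded_toTreeAut (e := .e)
        (grigorchukAutomaton.toTreeAut_eq_one rfl fun _ => rfl) q
        (fun n => List.replicate n 1) (fun n => List.replicate (n - 1) 1 ++ [0])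
        fun v => grigorchukAutomaton_active v q⟩
  rintro g (rfl | rfl | rfl | rfl) <;> exact h _

theorem basilicaGenerators_finiteState_bounded :
    ∀ g ∈ basilicaGenerators, TreeAut.IsFiniteState g ∧ TreeAut.IsBounded g := by
  have h : ∀ q, TreeAut.IsFiniteState (basilicaAutomaton.toTreeAut q) ∧
      TreeAut.IsBounded (basilicaAutomaton.toTreeAut q) := fun q =>
    ⟨basilicaAutomaton.isFiniteState_toTreeAut q,
      basilicaAutomaton.isBounded_toTreeAut (e := .e)
        (basilicaAutomaton.toTreeAut_eq_one rfl fun _ => rfl) q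
        (fun n => List.replicate n 1) (fun n => List.replicate n 1)
        fun v hv => Or.inl (basilicaAutomaton_active v q hv)⟩
  rintro g (rfl | rfl) <;> exact h _

theorem mainTheorem6 :
    (∀ (X : Type*) [Finite X] (S : Set (TreeAut X)),
      (∀ g ∈ S, TreeAut.IsFiniteState g ∧ TreeAut.IsBounded g) → IsAmenableGroup (Subgroup.closure S)) ∧
    ((∀ g ∈ grigorchukGenerators, TreeAut.IsFiniteState g ∧ TreeAut.IsBounded g) ∧
      IsAmenableGroup (Subgroup.closure grigorchukGenerators)) ∧
    ((∀ g ∈ basilicaGenerators, TreeAut.IsFiniteState g ∧ TreeAut.IsBounded g) ∧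
      IsAmenableGroup (Subgroup.closure basilicaGenerators)) :=
  ⟨fun _ _ _ hS => TreeAut.isAmenableGroup_closure hS,
    ⟨grigorchukGenerators_finiteState_bounded,
      TreeAut.isAmenableGroup_closure grigorchukGenerators_finiteState_bounded⟩,
    ⟨basilicaGenerators_finiteState_bounded,
      TreeAut.isAmenableGroup_closure basilicaGenerators_finiteState_bounded⟩⟩
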